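/- Let $A \in \mathbb{R}^{n\times n}$ and $B \in \mathbb{R}^{n\times m}$ be such that $(A,B)$ is controllable, i.e. $\operatorname{rank}[B, AB, \dots, A^{n-1}B] = n$. Let $$\mathcal{H}_s = \{K \in \mathbb{R}^{m\times n} : \text{every eigenvalue of } A-BK \text{ has negative real part}\}$$ be the set of Hurwitz-stabilizing state-feedback gains, with the topology induced from $\mathbb{R}^{m\times n}$. Then $\mathcal{H}_s$ is contractible. Moreover, for every symmetric positive definite $Q \in \mathbb{R}^{n\times n}$, the set $$\mathcal{L}_Q = \{(P,Y) \in \mathbb{R}^{n\times n}\times\mathbb{R}^{m\times n} : P = P^{\top} \succ 0,\ AP + PA^{\top} - BY - Y^{\top}B^{\top} + Q = 0\}$$ is convex, and the map $\varphi_Q : \mathcal{L}_Q \to \mathcal{H}_s$, $\varphi_Q(P,Y) = YP^{-1}$, is a real-analytic diffeomorphism, i.e. a bijection such that both $\varphi_Q$ and its inverse are, near each point of their domains, restrictions of real-analytic maps defined on open subsets of the ambient matrix spaces. -/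

import Mathlib

/- The entrywise sup norm on real matrices; since the spaces are finite-dimensional, analyticity and
the topology do not depend on this choice. -/
attribute [local instance] Matrix.normedAddCommGroup Matrix.normedSpace

namespace FeedbackGains

/-- A real square matrix is Hurwitz stable if all its complex eigenvalues have negative real
part. -/
def IsHurwitz {n : ℕ} (M : Matrix (Fin n) (Fin n) ℝ) : Prop :=
  ∀ z ∈ spectrum ℂ (M.map Complex.ofReal), z.re < 0

/-- The controllability matrix `[B, AB, …, A ^ (n - 1) B]`; the column `(k, j)` is the `j`-th
column of `A ^ k B`. -/
def controllabilityMatrix {n m : ℕ} (A : Matrix (Fin n) (Fin n) ℝ)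
    (B : Matrix (Fin n) (Fin m) ℝ) : Matrix (Fin n) (Fin n × Fin m) ℝ :=
  Matrix.of fun i kj => (A ^ (kj.1 : ℕ) * B) i kj.2

/-- The Kalman rank condition. -/
def Controllable {n m : ℕ} (A : Matrix (Fin n) (Fin n) ℝ)
    (B : Matrix (Fin n) (Fin m) ℝ) : Prop :=
  (controllabilityMatrix A B).rank = n

/-- The set of Hurwitz stabilizing state-feedback gains. -/
def hurwitzGains {n m : ℕ} (A : Matrix (Fin n) (Fin n) ℝ)
    (B : Matrix (Fin n) (Fin m) ℝ) : Set (Matrix (Fin m) (Fin n) ℝ) :=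
  {K | IsHurwitz (A - B * K)}

/-- The pairs `(P, Y)` with `P` symmetric positive definite that solve
`A P + P Aᵀ - B Y - Yᵀ Bᵀ + Q = 0`. -/
def lmiSet {n m : ℕ} (A : Matrix (Fin n) (Fin n) ℝ) (B : Matrix (Fin n) (Fin m) ℝ)
    (Q : Matrix (Fin n) (Fin n) ℝ) :
    Set (Matrix (Fin n) (Fin n) ℝ × Matrix (Fin m) (Fin n) ℝ) :=
  {p | p.1.PosDef ∧
    A * p.1 + p.1 * A.transpose - B * p.2 - p.2.transpose * B.transpose + Q = 0}

/-- The map `(P, Y) ↦ Y P⁻¹`. -/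
noncomputable def gainMap {n m : ℕ}
    (p : Matrix (Fin n) (Fin n) ℝ × Matrix (Fin m) (Fin n) ℝ) : Matrix (Fin m) (Fin n) ℝ :=
  p.2 * p.1⁻¹

/-- `f` restricts to a real-analytic diffeomorphism from the subset `s` of `E` onto the subset `t`
of `F`: it maps `s` bijectively onto `t`, and both `f` on `s` and its inverse on `t` are real
analytic. Analyticity on an arbitrary subset, `AnalyticOn`, means that near each point of the
subset the map is the restriction to the subset of a map that is analytic on an open neighbourhood
of the point in the ambient space (`analyticWithinAt_iff_exists_analyticAt`). -/
def IsAnalyticDiffeoOn {E F : Type*} [NormedAddCommGroup E] [NormedSpace ℝ E]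
    [NormedAddCommGroup F] [NormedSpace ℝ F] (f : E → F) (s : Set E) (t : Set F) : Prop :=
  Set.BijOn f s t ∧ AnalyticOn ℝ f s ∧ ∃ g : F → E, Set.InvOn g f s t ∧ AnalyticOn ℝ g t

end FeedbackGains

namespace FeedbackGains

open Matrix Module

variable {n m : ℕ}

/-! With `Y = K P` the constraint becomes the Lyapunov equation of `M = A - B K` (`mem_lmiSet_iff`).
A positive definite solution forces `M` to be Hurwitz (`isHurwitz_of_lyapunov`). Conversely, for
Hurwitz `M` the Lyapunov operator is invertible, so `P` is unique and analytic in `K`; it is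
positive definite by deforming `M` to `-1` (`IsHurwitz.posDef_lyapunovSol`). Hence `K ↦ (P, K P)`
inverts `gainMap`. The constraint is affine, so its solution set is convex, and contractible as soon
as it is nonempty. Controllability serves only to produce one stabilizing gain, built from the
Gramian of a shifted system (`Controllable.nonempty_hurwitzGains`). -/

theorem mem_spectrum_iff_exists_mulVec {K : Type*} [Field K] {M : Matrix (Fin n) (Fin n) K}
    {z : K} : z ∈ spectrum K M ↔ ∃ v : Fin n → K, v ≠ 0 ∧ M *ᵥ v = z • v := by
  rw [← Matrix.spectrum_toLin', ← End.hasEigenvalue_iff_mem_spectrum]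
  constructor
  · intro h
    obtain ⟨v, hv⟩ := h.exists_hasEigenvector
    exact ⟨v, hv.2, by simpa using hv.apply_eq_smul⟩
  · rintro ⟨v, hv, h⟩
    exact End.hasEigenvalue_of_hasEigenvector
      (x := v) ⟨End.mem_eigenspace_iff.mpr (by simpa using h), hv⟩

theorem isHurwitz_iff_mulVec {M : Matrix (Fin n) (Fin n) ℝ} :
    IsHurwitz M ↔ ∀ (z : ℂ) (v : Fin n → ℂ), v ≠ 0 →
      M.map Complex.ofReal *ᵥ v = z • v → z.re < 0 := by
  simp only [IsHurwitz, mem_spectrum_iff_exists_mulVec]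
  exact ⟨fun h z v hv e => h z ⟨v, hv, e⟩, fun h z ⟨v, hv, e⟩ => h z v hv e⟩

theorem mem_spectrum_transpose {K : Type*} [Field K] {M : Matrix (Fin n) (Fin n) K} {z : K} :
    z ∈ spectrum K Mᵀ ↔ z ∈ spectrum K M := by
  rw [mem_spectrum_iff_isRoot_charpoly, mem_spectrum_iff_isRoot_charpoly, charpoly_transpose]

theorem isHurwitz_transpose {M : Matrix (Fin n) (Fin n) ℝ} : IsHurwitz Mᵀ ↔ IsHurwitz M := by
  simp only [IsHurwitz, transpose_map, mem_spectrum_transpose]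

/-! ### Sylvester equations and the Lyapunov operator -/

/-- A matrix equation `M X = X N` forces `X = 0` when `M` and `N` have no common eigenvalue. -/
theorem eq_zero_of_mul_eq_mul_of_disjoint_spectrum {K : Type*} [Field K] [IsAlgClosed K]
    {M N X : Matrix (Fin n) (Fin n) K} (h : M * X = X * N)
    (hd : Disjoint (spectrum K M) (spectrum K N)) : X = 0 := by
  obtain rfl | hn := Nat.eq_zero_or_pos n
  · exact Subsingleton.elim _ _
  have key : ∀ p : Polynomial K, Polynomial.aeval M p * X = X * Polynomial.aeval N p := by
    intro p
    induction p using Polynomial.induction_on' with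
    | add p q hp hq => simp only [map_add, add_mul, mul_add, hp, hq]
    | monomial k a =>
      have hk : M ^ k * X = X * N ^ k := by
        induction k with
        | zero => simp
        | succ k ih => rw [pow_succ, mul_assoc, h, ← mul_assoc, ih, mul_assoc, ← pow_succ]
      rw [Polynomial.aeval_monomial, Polynomial.aeval_monomial, mul_assoc, hk,
        ← mul_assoc, ← mul_assoc, Algebra.commutes]
  -- By spectral mapping, the eigenvalues of `χ_M(N)` are the values of `χ_M` at eigenvalues of `N`,
  -- none of which is a root. Cayley–Hamilton then turns `key` into `0 = X * χ_M(N)`.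
  have hu : IsUnit (Polynomial.aeval N M.charpoly) := by
    rw [← spectrum.zero_notMem_iff K, spectrum.map_polynomial_aeval_of_degree_pos]
    · rintro ⟨z, hz, h0⟩
      exact Set.disjoint_left.mp hd (mem_spectrum_iff_isRoot_charpoly.mpr h0) hz
    · rw [charpoly_degree_eq_dim]; simpa using hn
  have h0 := key M.charpoly
  rw [aeval_self_charpoly, zero_mul] at h0
  exact (hu.mul_left_eq_zero).mp h0.symm

/-- The Lyapunov operator `X ↦ M X + X Mᵀ`, as a linear function of `M`. -/
noncomputable def lyapunov : Matrix (Fin n) (Fin n) ℝ →ₗ[ℝ]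
    (Matrix (Fin n) (Fin n) ℝ →L[ℝ] Matrix (Fin n) (Fin n) ℝ) :=
  LinearMap.toContinuousLinearMap.toLinearMap ∘ₗ
    (LinearMap.mul ℝ _ +
      (LinearMap.mul ℝ _).flip ∘ₗ (transposeLinearEquiv (Fin n) (Fin n) ℝ ℝ).toLinearMap)

@[simp]
theorem lyapunov_apply (M X : Matrix (Fin n) (Fin n) ℝ) : lyapunov M X = M * X + X * Mᵀ := rfl

theorem transpose_lyapunov (M X : Matrix (Fin n) (Fin n) ℝ) :
    (lyapunov M X)ᵀ = lyapunov M Xᵀ := by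
  simp [add_comm]

/-- Over `ℂ` a kernel element satisfies `M X = X (-Mᵀ)`, and the spectra of `M` and `-Mᵀ` lie in
opposite open half-planes. -/
theorem IsHurwitz.lyapunov_injective {M : Matrix (Fin n) (Fin n) ℝ} (hM : IsHurwitz M) :
    Function.Injective (lyapunov M) := by
  rw [injective_iff_map_eq_zero]
  intro X hX
  let c := (Complex.ofRealHom.mapMatrix : Matrix (Fin n) (Fin n) ℝ →+* _)
  have hc : c M * c X = c X * (-(c M)ᵀ) := by
    have := congrArg c hX
    rw [lyapunov_apply, map_add, map_mul, map_mul, map_zero] at this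
    rw [mul_neg]
    exact eq_neg_of_add_eq_zero_left this
  have h0 : c X = 0 := by
    refine eq_zero_of_mul_eq_mul_of_disjoint_spectrum hc (Set.disjoint_left.mpr ?_)
    intro z hz hz'
    rw [← spectrum.neg_eq, Set.mem_neg, mem_spectrum_transpose] at hz'
    have h1 := hM z hz
    have h2 := hM (-z) hz'
    rw [Complex.neg_re] at h2
    linarith
  ext i j
  exact Complex.ofReal_eq_zero.mp (congrFun (congrFun h0 i) j)

theorem IsHurwitz.isUnit_lyapunov {M : Matrix (Fin n) (Fin n) ℝ} (hM : IsHurwitz M) :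
    IsUnit (lyapunov M) :=
  ContinuousLinearMap.isUnit_iff_bijective.mpr ⟨hM.lyapunov_injective,
    LinearMap.injective_iff_surjective (f := (lyapunov M).toLinearMap) |>.mp
      hM.lyapunov_injective⟩

theorem apply_inverse_apply {E : Type*} [NormedAddCommGroup E] [NormedSpace ℝ E]
    {L : E →L[ℝ] E} (h : IsUnit L) (v : E) : L (Ring.inverse L v) = v := by
  rw [← mul_apply_eq_comp, Ring.mul_inverse_cancel _ h,
    one_apply_eq_self]

theorem inverse_apply_apply {E : Type*} [NormedAddCommGroup E] [NormedSpace ℝ E]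
    {L : E →L[ℝ] E} (h : IsUnit L) (v : E) : Ring.inverse L (L v) = v := by
  rw [← mul_apply_eq_comp, Ring.inverse_mul_cancel _ h,
    one_apply_eq_self]

theorem analyticAt_inverse_apply {E F : Type*} [NormedAddCommGroup E] [NormedSpace ℝ E]
    [CompleteSpace E] [NormedAddCommGroup F] [NormedSpace ℝ F] {L : F → E →L[ℝ] E} {x : F}
    (hL : AnalyticAt ℝ L x) (hu : IsUnit (L x)) (v : E) :
    AnalyticAt ℝ (fun y => Ring.inverse (L y) v) x := by
  obtain ⟨u, hu⟩ := hu
  have h1 : AnalyticAt ℝ Ring.inverse (L x) := hu ▸ analyticAt_inverse u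
  exact ((ContinuousLinearMap.apply ℝ E v).analyticAt _).comp (h1.comp hL)

theorem LinearMap.analyticAt_of_finiteDimensional {E F : Type*} [NormedAddCommGroup E]
    [NormedSpace ℝ E] [FiniteDimensional ℝ E] [NormedAddCommGroup F] [NormedSpace ℝ F]
    (f : E →ₗ[ℝ] F) (x : E) : AnalyticAt ℝ f x :=
  f.toContinuousLinearMap.analyticAt x

/-- The solution `P` of the Lyapunov equation `M P + P Mᵀ + Q = 0`. -/
noncomputable def lyapunovSol (M Q : Matrix (Fin n) (Fin n) ℝ) : Matrix (Fin n) (Fin n) ℝ :=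
  Ring.inverse (lyapunov M) (-Q)

section
variable {M Q : Matrix (Fin n) (Fin n) ℝ}

theorem IsHurwitz.lyapunov_sol (hM : IsHurwitz M) (Q : Matrix (Fin n) (Fin n) ℝ) :
    lyapunov M (lyapunovSol M Q) = -Q :=
  apply_inverse_apply hM.isUnit_lyapunov _

theorem IsHurwitz.eq_lyapunovSol (hM : IsHurwitz M) {P : Matrix (Fin n) (Fin n) ℝ}
    (h : lyapunov M P = -Q) : P = lyapunovSol M Q :=
  hM.lyapunov_injective (h.trans (hM.lyapunov_sol Q).symm)

theorem IsHurwitz.isSymm_lyapunovSol (hM : IsHurwitz M) (hQ : Q.IsSymm) :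
    (lyapunovSol M Q).IsSymm := by
  refine hM.eq_lyapunovSol ?_
  rw [← transpose_lyapunov, hM.lyapunov_sol, transpose_neg, hQ]

theorem IsHurwitz.analyticAt_lyapunovSol (hM : IsHurwitz M) (Q : Matrix (Fin n) (Fin n) ℝ) :
    AnalyticAt ℝ (fun N => lyapunovSol N Q) M :=
  analyticAt_inverse_apply (LinearMap.analyticAt_of_finiteDimensional lyapunov M)
    hM.isUnit_lyapunov _

/-! ### Lyapunov's theorem: stability and positivity -/

/-- The quadratic form of a Lyapunov operator. -/
theorem dotProduct_lyapunov_mulVec {P : Matrix (Fin n) (Fin n) ℝ} (hP : P.IsSymm)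
    (x : Fin n → ℝ) : x ⬝ᵥ (lyapunov M P) *ᵥ x = 2 * ((Mᵀ *ᵥ x) ⬝ᵥ P *ᵥ x) := by
  have h1 : x ⬝ᵥ (M * P) *ᵥ x = (Mᵀ *ᵥ x) ⬝ᵥ P *ᵥ x := by
    rw [← mulVec_mulVec, dotProduct_mulVec, mulVec_transpose]
  have h2 : x ⬝ᵥ (P * Mᵀ) *ᵥ x = (Mᵀ *ᵥ x) ⬝ᵥ P *ᵥ x := by
    rw [← mulVec_mulVec, dotProduct_mulVec, ← mulVec_transpose, hP.eq, dotProduct_comm]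
  rw [lyapunov_apply, add_mulVec, dotProduct_add, h1, h2]; ring

theorem dotProduct_mulVec_symm {P : Matrix (Fin n) (Fin n) ℝ} (hP : P.IsSymm)
    (x y : Fin n → ℝ) : x ⬝ᵥ P *ᵥ y = y ⬝ᵥ P *ᵥ x := by
  rw [dotProduct_mulVec, ← mulVec_transpose, hP.eq, dotProduct_comm]

theorem posDef_iff_real {P : Matrix (Fin n) (Fin n) ℝ} :
    P.PosDef ↔ P.IsSymm ∧ ∀ x : Fin n → ℝ, x ≠ 0 → 0 < x ⬝ᵥ P *ᵥ x := by
  rw [posDef_iff_dotProduct_mulVec]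
  simp only [star_trivial, IsHermitian, conjTranspose_eq_transpose_of_trivial, IsSymm]

theorem posSemidef_iff_real {P : Matrix (Fin n) (Fin n) ℝ} :
    P.PosSemidef ↔ P.IsSymm ∧ ∀ x : Fin n → ℝ, 0 ≤ x ⬝ᵥ P *ᵥ x := by
  rw [posSemidef_iff_dotProduct_mulVec]
  simp only [star_trivial, IsHermitian, conjTranspose_eq_transpose_of_trivial, IsSymm]

/-- For an eigenvector `a + ib` of `Mᵀ`, adding the quadratic forms at `a` and `b` cancels the
`z.im` terms and leaves `2 Re z (aᵀPa + bᵀPb) = -(aᵀQa + bᵀQb)`. -/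
theorem isHurwitz_of_lyapunov {P : Matrix (Fin n) (Fin n) ℝ} (hP : P.PosDef) (hQ : Q.PosDef)
    (h : lyapunov M P = -Q) : IsHurwitz M := by
  rw [posDef_iff_real] at hP hQ
  rw [← isHurwitz_transpose, isHurwitz_iff_mulVec]
  intro z v hv hz
  set a : Fin n → ℝ := fun i => (v i).re with ha
  set b : Fin n → ℝ := fun i => (v i).im with hb
  have hMa : Mᵀ *ᵥ a = z.re • a - z.im • b := by
    ext i
    simpa [mulVec, dotProduct, ha, hb] using congrArg Complex.re (congrFun hz i)
  have hMb : Mᵀ *ᵥ b = z.re • b + z.im • a := by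
    ext i
    simpa [mulVec, dotProduct, ha, hb] using congrArg Complex.im (congrFun hz i)
  have ea := dotProduct_lyapunov_mulVec (M := M) hP.1 a
  have eb := dotProduct_lyapunov_mulVec (M := M) hP.1 b
  rw [h, neg_mulVec, dotProduct_neg] at ea eb
  rw [hMa, sub_dotProduct, smul_dotProduct, smul_dotProduct] at ea
  rw [hMb, add_dotProduct, smul_dotProduct, smul_dotProduct, dotProduct_mulVec_symm hP.1 a b] at eb
  simp only [smul_eq_mul] at ea eb
  have nonneg : ∀ {S : Matrix (Fin n) (Fin n) ℝ}, (∀ x : Fin n → ℝ, x ≠ 0 → 0 < x ⬝ᵥ S *ᵥ x) →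
      ∀ x, 0 ≤ x ⬝ᵥ S *ᵥ x := by
    intro S hS x
    by_cases hx : x = 0
    · simp [hx]
    · exact (hS x hx).le
  have hab : a ≠ 0 ∨ b ≠ 0 := by
    by_contra! hc
    exact hv (funext fun i => Complex.ext (congrFun hc.1 i) (congrFun hc.2 i))
  have pos : ∀ {S : Matrix (Fin n) (Fin n) ℝ}, (∀ x : Fin n → ℝ, x ≠ 0 → 0 < x ⬝ᵥ S *ᵥ x) →
      0 < a ⬝ᵥ S *ᵥ a + b ⬝ᵥ S *ᵥ b := by
    intro S hS
    rcases hab with h | h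
    · exact add_pos_of_pos_of_nonneg (hS a h) (nonneg hS b)
    · exact add_pos_of_nonneg_of_pos (nonneg hS a) (hS b h)
  have h1 := pos hP.2
  have h2 := pos hQ.2
  have h3 : z.re * (2 * (a ⬝ᵥ P *ᵥ a + b ⬝ᵥ P *ᵥ b)) < 0 := by linarith
  exact neg_of_mul_neg_left h3 (by positivity)

/-- The eigenvalues are `(1 - s) λ - s` with `λ` an eigenvalue of `M`; the endpoint `s = 1`, where
`λ` cannot be recovered, is separate. -/
theorem IsHurwitz.segment (hM : IsHurwitz M) {s : ℝ} (hs : s ∈ Set.Icc (0 : ℝ) 1) :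
    IsHurwitz ((1 - s) • M - s • (1 : Matrix (Fin n) (Fin n) ℝ)) := by
  rw [isHurwitz_iff_mulVec] at hM ⊢
  intro z v hv hz
  have hc : ((1 - s) • M - s • (1 : Matrix (Fin n) (Fin n) ℝ)).map Complex.ofReal =
      ((1 - s : ℝ) : ℂ) • M.map Complex.ofReal - (s : ℂ) • 1 := by
    ext i j
    by_cases hij : i = j <;> simp [one_apply, hij]
  rw [hc, sub_mulVec, smul_mulVec, smul_mulVec, one_mulVec, sub_eq_iff_eq_add, ← add_smul] at hz
  obtain rfl | hs1 := eq_or_lt_of_le hs.2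
  · have h0 : (z + 1) • v = 0 := by simpa using hz.symm
    have : z = -1 := eq_neg_of_add_eq_zero_left ((smul_eq_zero.mp h0).resolve_right hv)
    simp [this]
  · have hpos : 0 < 1 - s := by linarith
    have hne : ((1 - s : ℝ) : ℂ) ≠ 0 := by exact_mod_cast hpos.ne'
    have := hM (((1 - s : ℝ) : ℂ)⁻¹ * (z + s)) v hv (by
      rw [mul_smul, ← hz, smul_smul, inv_mul_cancel₀ hne, one_smul])
    rw [← Complex.ofReal_inv, Complex.re_ofReal_mul, Complex.add_re, Complex.ofReal_re] at this
    have h2 := neg_of_mul_neg_right this (inv_nonneg.mpr hpos.le)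
    linarith [hs.1]

/-- A continuous path of symmetric matrices with trivial kernels that ends in a positive definite
matrix starts in one. -/
theorem posDef_of_path {p : ℝ → Matrix (Fin n) (Fin n) ℝ} (hc : ContinuousOn p (Set.Icc 0 1))
    (hs : ∀ s ∈ Set.Icc (0 : ℝ) 1, (p s).IsSymm)
    (hk : ∀ s ∈ Set.Icc (0 : ℝ) 1, ∀ x, p s *ᵥ x = 0 → x = 0) (h1 : (p 1).PosDef) :
    (p 0).PosDef := by
  obtain rfl | hn := Nat.eq_zero_or_pos n
  · rwa [Subsingleton.elim (p 0) (p 1)]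
  have : Nonempty (Fin n) := ⟨⟨0, hn⟩⟩
  let S : Set (Fin n → ℝ) := Metric.sphere 0 1
  have hS : IsCompact S := isCompact_sphere _ _
  have hne : S.Nonempty := NormedSpace.sphere_nonempty.mpr zero_le_one
  let q : Matrix (Fin n) (Fin n) ℝ → (Fin n → ℝ) → ℝ := fun P x => x ⬝ᵥ P *ᵥ x
  have hq : Continuous ↿q := by
    change Continuous fun r : Matrix (Fin n) (Fin n) ℝ × (Fin n → ℝ) => r.2 ⬝ᵥ r.1 *ᵥ r.2
    fun_prop
  -- The minimum of the quadratic form over the unit sphere is continuous in the matrix, and its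
  -- sign detects definiteness.
  let f : Matrix (Fin n) (Fin n) ℝ → ℝ := fun P => sInf (q P '' S)
  have hf : Continuous f := hS.continuous_sInf hq
  have hmin : ∀ P, ∃ x ∈ S, f P = q P x := fun P =>
    hS.exists_sInf_image_eq hne (hq.comp (Continuous.prodMk_right P)).continuousOn
  have hle : ∀ P, ∀ x : Fin n → ℝ, f P * ‖x‖ ^ 2 ≤ x ⬝ᵥ P *ᵥ x := by
    intro P x
    by_cases hx : x = 0
    · simp [hx]
    have hx' : 0 < ‖x‖ := norm_pos_iff.mpr hx
    have hb : f P ≤ q P (‖x‖⁻¹ • x) :=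
      csInf_le (hS.image (hq.comp (Continuous.prodMk_right P))).bddBelow
        ⟨_, by simp [S, norm_smul, hx'.ne'], rfl⟩
    simp only [q, mulVec_smul, dotProduct_smul, smul_dotProduct, smul_eq_mul] at hb
    calc f P * ‖x‖ ^ 2 ≤ (‖x‖⁻¹ * (‖x‖⁻¹ * (x ⬝ᵥ P *ᵥ x))) * ‖x‖ ^ 2 := by gcongr
      _ = x ⬝ᵥ P *ᵥ x := by field_simp
  have hpos : 0 < f (p 1) := by
    obtain ⟨x, hx, e⟩ := hmin (p 1)
    rw [e]
    exact (posDef_iff_real.mp h1).2 x (ne_zero_of_mem_unit_sphere ⟨x, hx⟩)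
  -- Otherwise the minimum vanishes at some `s`; there `p s` is semidefinite, so a minimizer lies in
  -- its kernel.
  have h0 : 0 < f (p 0) := by
    by_contra! hneg
    obtain ⟨s, hsI, hs0⟩ := intermediate_value_Icc (zero_le_one' ℝ)
      (hf.comp_continuousOn hc) ⟨hneg, hpos.le⟩
    simp only [Function.comp] at hs0
    have hps : (p s).PosSemidef := posSemidef_iff_real.mpr
      ⟨hs s hsI, fun x => by simpa [hs0] using hle (p s) x⟩
    obtain ⟨x, hx, e⟩ := hmin (p s)
    have hx0 : p s *ᵥ x = 0 := by
      rw [← hps.dotProduct_mulVec_zero_iff, star_trivial]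
      exact e.symm.trans hs0
    exact ne_zero_of_mem_unit_sphere ⟨x, hx⟩ (hk s hsI x hx0)
  refine posDef_iff_real.mpr ⟨hs 0 (by simp), fun x hx => ?_⟩
  have hx' : 0 < ‖x‖ := norm_pos_iff.mpr hx
  exact lt_of_lt_of_le (by positivity) (hle (p 0) x)

/-- Along the segment from `M` to `-1`, a kernel vector `x` of the solution would give `xᵀQx = 0`;
at the end the solution is `Q / 2`. -/
theorem IsHurwitz.posDef_lyapunovSol (hM : IsHurwitz M) (hQ : Q.PosDef) :
    (lyapunovSol M Q).PosDef := by
  have hQs := (posDef_iff_real.mp hQ).1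
  let N : ℝ → Matrix (Fin n) (Fin n) ℝ := fun s => (1 - s) • M - s • 1
  have hN : ∀ s ∈ Set.Icc (0 : ℝ) 1, IsHurwitz (N s) := fun s hs => hM.segment hs
  have hNc : Continuous N := by fun_prop
  have h : (lyapunovSol (N 0) Q).PosDef := by
    refine posDef_of_path (p := fun s => lyapunovSol (N s) Q) ?_
      (fun s hs => (hN s hs).isSymm_lyapunovSol hQs) ?_ ?_
    · intro s hs
      exact (ContinuousAt.comp (g := fun K => lyapunovSol K Q)
        ((hN s hs).analyticAt_lyapunovSol Q).continuousAt hNc.continuousAt).continuousWithinAt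
    · intro s hs x hx
      by_contra hx0
      have e := dotProduct_lyapunov_mulVec (M := N s) ((hN s hs).isSymm_lyapunovSol hQs) x
      rw [(hN s hs).lyapunov_sol, hx, neg_mulVec, dotProduct_neg, dotProduct_zero] at e
      linarith [(posDef_iff_real.mp hQ).2 x hx0]
    · have e : lyapunovSol (N 1) Q = (2⁻¹ : ℝ) • Q := by
        refine ((hN 1 (by simp)).eq_lyapunovSol ?_).symm
        simp only [lyapunov_apply, N]
        ext i j
        simp
        ring
      change (lyapunovSol (N 1) Q).PosDef
      rw [e]
      exact hQ.smul (by norm_num)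
  simpa [N] using h

/-- Perturb `Q` to `Q + ε • 1` and let `ε → 0`. This is needed for `B * Bᵀ`, which need not be
definite. -/
theorem IsHurwitz.posSemidef_lyapunovSol (hM : IsHurwitz M) (hQ : Q.PosSemidef) :
    (lyapunovSol M Q).PosSemidef := by
  refine posSemidef_iff_real.mpr
    ⟨hM.isSymm_lyapunovSol (posSemidef_iff_real.mp hQ).1, fun x => ?_⟩
  have h : ∀ ε : ℝ, 0 < ε →
      0 ≤ x ⬝ᵥ lyapunovSol M Q *ᵥ x + ε * (x ⬝ᵥ lyapunovSol M 1 *ᵥ x) := by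
    intro ε hε
    have hp := hM.posDef_lyapunovSol (PosDef.posSemidef_add hQ (PosDef.one.smul hε))
    have e : lyapunovSol M (Q + ε • 1) = lyapunovSol M Q + ε • lyapunovSol M 1 := by
      simp only [lyapunovSol, neg_add, map_add, ← smul_neg, map_smul]
    have := (posSemidef_iff_real.mp hp.posSemidef).2 x
    rwa [e, add_mulVec, smul_mulVec, dotProduct_add, dotProduct_smul, smul_eq_mul] at this
  have hl : Filter.Tendsto
      (fun ε : ℝ => x ⬝ᵥ lyapunovSol M Q *ᵥ x + ε * (x ⬝ᵥ lyapunovSol M 1 *ᵥ x))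
      (nhdsWithin 0 (Set.Ioi 0)) (nhds (x ⬝ᵥ lyapunovSol M Q *ᵥ x)) := by
    refine Filter.Tendsto.mono_left ?_ nhdsWithin_le_nhds
    have : Continuous fun ε : ℝ =>
      x ⬝ᵥ lyapunovSol M Q *ᵥ x + ε * (x ⬝ᵥ lyapunovSol M 1 *ᵥ x) := by fun_prop
    simpa using this.tendsto 0
  exact ge_of_tendsto hl (Filter.eventually_of_mem self_mem_nhdsWithin h)

end

/-! ### Controllability and existence of a stabilizing gain -/

theorem Controllable.eq_zero {A : Matrix (Fin n) (Fin n) ℝ} {B : Matrix (Fin n) (Fin m) ℝ}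
    (h : Controllable A B) {x : Fin n → ℝ} (hx : ∀ k : ℕ, x ᵥ* (A ^ k * B) = 0) : x = 0 := by
  have hli : LinearIndependent ℝ (controllabilityMatrix A B).row := by
    rw [linearIndependent_iff_card_eq_finrank_span, Set.finrank, ← rank_eq_finrank_span_row]
    simpa using h.symm
  refine vecMul_injective_iff.mpr hli ?_
  change x ᵥ* controllabilityMatrix A B = 0 ᵥ* controllabilityMatrix A B
  rw [zero_vecMul]
  ext ⟨k, j⟩
  simpa [vecMul, dotProduct, controllabilityMatrix] using congrFun (hx k) j

/-- Positive definiteness of the controllability Gramian. -/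
theorem Controllable.posDef_lyapunovSol {A : Matrix (Fin n) (Fin n) ℝ}
    {B : Matrix (Fin n) (Fin m) ℝ} (h : Controllable A B) {β : ℝ}
    (hM : IsHurwitz (-(A + β • (1 : Matrix (Fin n) (Fin n) ℝ)))) :
    (lyapunovSol (-(A + β • (1 : Matrix (Fin n) (Fin n) ℝ))) (B * Bᵀ)).PosDef := by
  set M := -(A + β • (1 : Matrix (Fin n) (Fin n) ℝ)) with hMdef
  have hBB : (B * Bᵀ).PosSemidef := by simpa using posSemidef_self_mul_conjTranspose B
  have hZ := hM.posSemidef_lyapunovSol hBB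
  set Z := lyapunovSol M (B * Bᵀ) with hZdef
  have hZs := (posSemidef_iff_real.mp hZ).1
  -- The kernel of the Gramian is `Aᵀ`-invariant and contained in that of `Bᵀ`, so its vectors
  -- annihilate every `A ^ k * B`.
  have step : ∀ x, Z *ᵥ x = 0 → x ᵥ* B = 0 ∧ Z *ᵥ (x ᵥ* A) = 0 := by
    intro x hx
    have e := dotProduct_lyapunov_mulVec (M := M) hZs x
    rw [hM.lyapunov_sol, hx, dotProduct_zero, mul_zero, neg_mulVec, dotProduct_neg,
      neg_eq_zero, ← mulVec_mulVec, dotProduct_mulVec, mulVec_transpose,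
      dotProduct_self_eq_zero] at e
    refine ⟨e, ?_⟩
    have e2 := congrArg (· *ᵥ x) (hM.lyapunov_sol (B * Bᵀ))
    simp only [lyapunov_apply, ← hZdef, add_mulVec, neg_mulVec, ← mulVec_mulVec, hx, mulVec_zero,
      mulVec_transpose, e, neg_zero, zero_add] at e2
    rw [hMdef, vecMul_neg, vecMul_add, vecMul_smul, vecMul_one, mulVec_neg, mulVec_add,
      mulVec_smul, hx, smul_zero, add_zero, neg_eq_zero] at e2
    exact e2
  rw [posDef_iff_real]
  refine ⟨hZs, fun x hx => lt_of_le_of_ne ((posSemidef_iff_real.mp hZ).2 x) fun h0 => hx ?_⟩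
  have hx0 : Z *ᵥ x = 0 := by
    rw [← hZ.dotProduct_mulVec_zero_iff, star_trivial, ← h0]
  have hk : ∀ k : ℕ, Z *ᵥ (x ᵥ* A ^ k) = 0 := by
    intro k
    induction k with
    | zero => simpa using hx0
    | succ k ih => rw [pow_succ, ← vecMul_vecMul]; exact (step _ ih).2
  exact h.eq_zero fun k => by rw [← vecMul_vecMul]; exact (step _ (hk k)).1

theorem exists_isHurwitz_neg_add_smul_one (A : Matrix (Fin n) (Fin n) ℝ) :
    ∃ β : ℝ, 0 < β ∧ IsHurwitz (-(A + β • (1 : Matrix (Fin n) (Fin n) ℝ))) := by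
  obtain ⟨c, hc⟩ := ((finite_spectrum (A.map Complex.ofReal)).image Complex.re).bddBelow
  -- An eigenvalue `z` of the shifted matrix makes `-z - β` an eigenvalue of `A`, whence `Re z ≤ -c
  -- - |c| - 1 < 0`.
  refine ⟨|c| + 1, by positivity, isHurwitz_iff_mulVec.mpr fun z v hv hz => ?_⟩
  have hcm : (-(A + (|c| + 1) • (1 : Matrix (Fin n) (Fin n) ℝ))).map Complex.ofReal =
      -(A.map Complex.ofReal + ((|c| + 1 : ℝ) : ℂ) • 1) := by
    ext i j
    by_cases hij : i = j <;> simp [one_apply, hij]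
  rw [hcm, neg_mulVec, add_mulVec, smul_mulVec, one_mulVec, neg_eq_iff_eq_neg,
    ← eq_sub_iff_add_eq, ← neg_smul, ← sub_smul] at hz
  have h1 := hc ⟨_, mem_spectrum_iff_exists_mulVec.mpr ⟨v, hv, hz⟩, rfl⟩
  rw [Complex.sub_re, Complex.neg_re, Complex.ofReal_re] at h1
  linarith [neg_abs_le c]

theorem mem_lmiSet_iff {A : Matrix (Fin n) (Fin n) ℝ} {B : Matrix (Fin n) (Fin m) ℝ}
    {Q P : Matrix (Fin n) (Fin n) ℝ} {Y : Matrix (Fin m) (Fin n) ℝ} :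
    (P, Y) ∈ lmiSet A B Q ↔ P.PosDef ∧ lyapunov (A - B * (Y * P⁻¹)) P = -Q := by
  refine and_congr_right fun hP => ?_
  have hu : IsUnit P.det := (isUnit_iff_isUnit_det P).mp hP.isUnit
  have hPt : Pᵀ = P := (posDef_iff_real.mp hP).1
  have e1 : B * (Y * P⁻¹) * P = B * Y := by
    rw [Matrix.mul_assoc, Matrix.mul_assoc, nonsing_inv_mul _ hu, Matrix.mul_one]
  have e2 : P * (B * (Y * P⁻¹))ᵀ = Yᵀ * Bᵀ := by
    rw [← transpose_mul B Y, ← e1, transpose_mul _ P, hPt]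
  rw [lyapunov_apply, transpose_sub, sub_mul, mul_sub, e1, e2, eq_neg_iff_add_eq_zero]
  refine Eq.congr_left ?_
  abel

/-- Bass's construction: the Gramian satisfies `A Z + Z Aᵀ + 2β Z = B Bᵀ`, which is the constraint
for `Y = Bᵀ` and the positive definite `Q = B Bᵀ + 2β Z`. -/
theorem Controllable.nonempty_hurwitzGains {A : Matrix (Fin n) (Fin n) ℝ}
    {B : Matrix (Fin n) (Fin m) ℝ} (h : Controllable A B) : (hurwitzGains A B).Nonempty := by
  obtain ⟨β, hβ, hM⟩ := exists_isHurwitz_neg_add_smul_one A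
  have hZ := h.posDef_lyapunovSol hM
  have e := hM.lyapunov_sol (B * Bᵀ)
  set Z := lyapunovSol (-(A + β • (1 : Matrix (Fin n) (Fin n) ℝ))) (B * Bᵀ)
  have hm : (Z, Bᵀ) ∈ lmiSet A B (B * Bᵀ + (2 * β) • Z) := by
    refine ⟨hZ, ?_⟩
    rw [lyapunov_apply, transpose_neg, transpose_add, transpose_smul, transpose_one, neg_mul,
      mul_neg, ← neg_add, neg_inj, add_mul, mul_add, smul_mul_assoc, mul_smul_comm, one_mul,
      mul_one] at e
    simp only [transpose_transpose, ← e, two_mul, add_smul]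
    abel
  refine ⟨Bᵀ * Z⁻¹, isHurwitz_of_lyapunov hZ ?_ (mem_lmiSet_iff.mp hm).2⟩
  exact PosDef.posSemidef_add (by simpa using posSemidef_self_mul_conjTranspose B)
    (hZ.smul (by positivity))

/-! ### Convexity, and analyticity of the map and its inverse -/

theorem convex_lmiSet (A : Matrix (Fin n) (Fin n) ℝ) (B : Matrix (Fin n) (Fin m) ℝ)
    (Q : Matrix (Fin n) (Fin n) ℝ) : Convex ℝ (lmiSet A B Q) := by
  rw [convex_iff_forall_pos]
  rintro ⟨P, Y⟩ ⟨hP, hPY⟩ ⟨P', Y'⟩ ⟨hP', hPY'⟩ a b ha hb hab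
  refine ⟨(hP.smul ha).add (hP'.smul hb), ?_⟩
  have h := congrArg₂ (fun X X' => a • X + b • X') hPY hPY'
  have hQ : Q = a • Q + b • Q := by rw [← add_smul, hab, one_smul]
  simp only [smul_zero, add_zero] at h
  rw [← h]
  conv_lhs => rw [hQ]
  simp only [Prod.smul_mk, Prod.mk_add_mk, transpose_add, transpose_smul, Matrix.mul_add,
    Matrix.add_mul, Matrix.mul_smul, Matrix.smul_mul, smul_add, smul_sub]
  abel

/-- The inverse of `gainMap` on the stabilizing gains. -/
noncomputable def gainInv (A : Matrix (Fin n) (Fin n) ℝ) (B : Matrix (Fin n) (Fin m) ℝ)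
    (Q : Matrix (Fin n) (Fin n) ℝ) (K : Matrix (Fin m) (Fin n) ℝ) :
    Matrix (Fin n) (Fin n) ℝ × Matrix (Fin m) (Fin n) ℝ :=
  (lyapunovSol (A - B * K) Q, K * lyapunovSol (A - B * K) Q)

/-- Matrix multiplication as a continuous bilinear map. -/
noncomputable def mulCLM (l k r : ℕ) : Matrix (Fin l) (Fin k) ℝ →L[ℝ]
    Matrix (Fin k) (Fin r) ℝ →L[ℝ] Matrix (Fin l) (Fin r) ℝ :=
  LinearMap.toContinuousLinearMap
    (LinearMap.toContinuousLinearMap.toLinearMap ∘ₗ mulLinearMap ℝ)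

theorem AnalyticAt.matrix_mul {l k r : ℕ} {E : Type*} [NormedAddCommGroup E] [NormedSpace ℝ E]
    {f : E → Matrix (Fin l) (Fin k) ℝ} {g : E → Matrix (Fin k) (Fin r) ℝ} {x : E}
    (hf : AnalyticAt ℝ f x) (hg : AnalyticAt ℝ g x) : AnalyticAt ℝ (fun y => f y * g y) x :=
  AnalyticAt.comp₂ (h := fun q : Matrix (Fin l) (Fin k) ℝ × Matrix (Fin k) (Fin r) ℝ =>
    mulCLM l k r q.1 q.2) ((mulCLM l k r).analyticAt_bilinear (f x, g x)) hf hg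

theorem isUnit_mulCLM {P : Matrix (Fin n) (Fin n) ℝ} (hP : IsUnit P) :
    IsUnit (mulCLM n n n P) :=
  ContinuousLinearMap.isUnit_iff_bijective.mpr (IsUnit.isUnit_iff_mulLeft_bijective.mp hP)

/-- Near `P`, `M⁻¹` is the inverse of the operator of left multiplication by `M`, applied to `1`. -/
theorem analyticAt_matrix_inv {P : Matrix (Fin n) (Fin n) ℝ} (hP : IsUnit P) :
    AnalyticAt ℝ (fun M : Matrix (Fin n) (Fin n) ℝ => M⁻¹) P := by
  refine (analyticAt_inverse_apply ((mulCLM n n n).analyticAt P) (isUnit_mulCLM hP) 1).congr ?_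
  have hd : IsOpen {M : Matrix (Fin n) (Fin n) ℝ | M.det ≠ 0} :=
    isOpen_ne_fun (by fun_prop) continuous_const
  have hPd : P.det ≠ 0 := ((isUnit_iff_isUnit_det P).mp hP).ne_zero
  filter_upwards [hd.mem_nhds hPd] with M hM
  have hu : IsUnit M.det := isUnit_iff_ne_zero.mpr hM
  have h := inverse_apply_apply (isUnit_mulCLM ((isUnit_iff_isUnit_det M).mpr hu)) M⁻¹
  have e : mulCLM n n n M M⁻¹ = 1 := mul_nonsing_inv M hu
  exact (congrArg (fun X => Ring.inverse (mulCLM n n n M) X) e).symm.trans h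

theorem analyticOn_gainMap (A : Matrix (Fin n) (Fin n) ℝ) (B : Matrix (Fin n) (Fin m) ℝ)
    (Q : Matrix (Fin n) (Fin n) ℝ) : AnalyticOn ℝ gainMap (lmiSet A B Q) := by
  rintro p hp
  exact (AnalyticAt.matrix_mul analyticAt_snd
    ((analyticAt_matrix_inv hp.1.isUnit).comp analyticAt_fst)).analyticWithinAt

theorem analyticOn_gainInv (A : Matrix (Fin n) (Fin n) ℝ) (B : Matrix (Fin n) (Fin m) ℝ)
    (Q : Matrix (Fin n) (Fin n) ℝ) : AnalyticOn ℝ (gainInv A B Q) (hurwitzGains A B) := by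
  intro K hK
  have h1 : AnalyticAt ℝ (fun K => A - B * K) K :=
    analyticAt_const.sub (AnalyticAt.matrix_mul analyticAt_const analyticAt_id)
  have h2 : AnalyticAt ℝ (fun K => lyapunovSol (A - B * K) Q) K :=
    AnalyticAt.comp (g := fun N => lyapunovSol N Q) (IsHurwitz.analyticAt_lyapunovSol hK Q) h1
  exact (h2.prod (AnalyticAt.matrix_mul analyticAt_id h2)).analyticWithinAt

/-! ### The diffeomorphism and contractibility -/

section
variable {A Q : Matrix (Fin n) (Fin n) ℝ} {B : Matrix (Fin n) (Fin m) ℝ}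

theorem mapsTo_gainMap (hQ : Q.PosDef) :
    Set.MapsTo gainMap (lmiSet A B Q) (hurwitzGains A B) := fun _ hp =>
  isHurwitz_of_lyapunov hp.1 hQ (mem_lmiSet_iff.mp hp).2

theorem gainMap_gainInv (hQ : Q.PosDef) {K : Matrix (Fin m) (Fin n) ℝ}
    (hK : K ∈ hurwitzGains A B) : gainMap (gainInv A B Q K) = K := by
  have hu := (isUnit_iff_isUnit_det _).mp (IsHurwitz.posDef_lyapunovSol hK hQ).isUnit
  rw [gainMap, gainInv, Matrix.mul_assoc, mul_nonsing_inv _ hu, Matrix.mul_one]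

theorem mapsTo_gainInv (hQ : Q.PosDef) :
    Set.MapsTo (gainInv A B Q) (hurwitzGains A B) (lmiSet A B Q) := fun K hK => by
  refine mem_lmiSet_iff.mpr ⟨IsHurwitz.posDef_lyapunovSol hK hQ, ?_⟩
  have h : K * lyapunovSol (A - B * K) Q * (lyapunovSol (A - B * K) Q)⁻¹ = K :=
    gainMap_gainInv hQ hK
  rw [h]
  exact IsHurwitz.lyapunov_sol hK Q

theorem gainInv_gainMap (hQ : Q.PosDef)
    {p : Matrix (Fin n) (Fin n) ℝ × Matrix (Fin m) (Fin n) ℝ} (hp : p ∈ lmiSet A B Q) :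
    gainInv A B Q (gainMap p) = p := by
  have h : p.1 = lyapunovSol (A - B * gainMap p) Q :=
    IsHurwitz.eq_lyapunovSol (mapsTo_gainMap hQ hp) (mem_lmiSet_iff.mp hp).2
  have hu := (isUnit_iff_isUnit_det _).mp hp.1.isUnit
  rw [gainInv, ← h, gainMap, Matrix.mul_assoc, nonsing_inv_mul _ hu, Matrix.mul_one]

theorem invOn_gainInv_gainMap (hQ : Q.PosDef) :
    Set.InvOn (gainInv A B Q) gainMap (lmiSet A B Q) (hurwitzGains A B) :=
  ⟨fun _ hp => gainInv_gainMap hQ hp, fun _ hK => gainMap_gainInv hQ hK⟩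

theorem isAnalyticDiffeoOn_gainMap (hQ : Q.PosDef) :
    IsAnalyticDiffeoOn gainMap (lmiSet A B Q) (hurwitzGains A B) :=
  ⟨(invOn_gainInv_gainMap hQ).bijOn (mapsTo_gainMap hQ) (mapsTo_gainInv hQ),
    analyticOn_gainMap A B Q, gainInv A B Q, invOn_gainInv_gainMap hQ, analyticOn_gainInv A B Q⟩

/-- The homeomorphism between the stabilizing gains and the solutions of the Lyapunov LMI. -/
noncomputable def hurwitzGainsHomeomorph (hQ : Q.PosDef) :
    hurwitzGains A B ≃ₜ lmiSet A B Q where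
  toFun := (mapsTo_gainInv hQ).restrict
  invFun := (mapsTo_gainMap hQ).restrict
  left_inv K := Subtype.ext (gainMap_gainInv hQ K.2)
  right_inv p := Subtype.ext (gainInv_gainMap hQ p.2)
  continuous_toFun := (analyticOn_gainInv A B Q).continuousOn.mapsToRestrict (mapsTo_gainInv hQ)
  continuous_invFun := (analyticOn_gainMap A B Q).continuousOn.mapsToRestrict (mapsTo_gainMap hQ)

/-- Any positive definite `Q` would do; `Q = 1` is chosen. The stabilizing gain is used only to see
that the convex set is nonempty. -/
theorem Controllable.contractibleSpace_hurwitzGains (h : Controllable A B) :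
    ContractibleSpace (hurwitzGains A B) := by
  obtain ⟨K, hK⟩ := h.nonempty_hurwitzGains
  have hne : (lmiSet A B 1).Nonempty := ⟨_, mapsTo_gainInv PosDef.one hK⟩
  have := (convex_lmiSet A B 1).contractibleSpace hne
  exact (hurwitzGainsHomeomorph PosDef.one).contractibleSpace

end

end FeedbackGains

theorem mainTheorem4 {n m : ℕ} (A : Matrix (Fin n) (Fin n) ℝ) (B : Matrix (Fin n) (Fin m) ℝ)
    (hAB : FeedbackGains.Controllable A B) :
    ContractibleSpace (FeedbackGains.hurwitzGains A B) ∧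
    ∀ Q : Matrix (Fin n) (Fin n) ℝ, Q.PosDef →
      Convex ℝ (FeedbackGains.lmiSet A B Q) ∧
      FeedbackGains.IsAnalyticDiffeoOn FeedbackGains.gainMap
        (FeedbackGains.lmiSet A B Q) (FeedbackGains.hurwitzGains A B) := by
  exact ⟨hAB.contractibleSpace_hurwitzGains, fun Q hQ =>
    ⟨FeedbackGains.convex_lmiSet A B Q, FeedbackGains.isAnalyticDiffeoOn_gainMap hQ⟩⟩
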